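/- Let $d,q\ge 1$ be integers. A $d$-array of size $(n_1,\dots,n_d)$ over the alphabet $\{1,\dots,q\}$ is a family of symbols $a_{\mathbf i}\in\{1,\dots,q\}$ indexed by $\mathbf i\in[n_1]\times\cdots\times[n_d]$, where $[n]=\{1,\dots,n\}$; it has order $n$ if $n_1=\cdots=n_d=n$. A coordinate restriction of such an array chooses some $j\in[d]$ and $\ell\in[n_j]$ and deletes all symbols whose $j$-th coordinate is $\ell$, which gives a $d$-array of size $(n_1,\dots,n_{j-1},n_j-1,n_{j+1},\dots,n_d)$. A $d$-array contains another one if the latter can be obtained from it by a finite (possibly empty) sequence of coordinate restrictions. A $d$-array is $k$-universal if it contains every $d$-array over the same alphabet of size $(n_1,\dots,n_d)$ with $n_j\le k$ for all $j\in[d]$. Let $f_d(q,k)$ be the minimum $n$ such that there is a $k$-universal $d$-array of order $n$ over $\{1,\dots,q\}$. Let $d,q\ge 2$ be fixed integers. Then the minimum $f_d(q,k)$ exists for every $k\ge 1$, and, as $k\to\infty$, $$f_d(q,k)=(1+o(1))\,\frac{k}{e}\,q^{k^{d-1}/d}.$$ -/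

import Mathlib

open Filter

/-- A `d`-dimensional array of size `n = (n₁, …, n_d)` over the `q`-symbol alphabet: a symbol for
every index vector in `[n₁] × ⋯ × [n_d]` (indices are numbered from `0`). -/
def DArray (q : ℕ) {d : ℕ} (n : Fin d → ℕ) : Type :=
  ((j : Fin d) → Fin (n j)) → Fin q

namespace DArray

/-- Coordinate restriction: delete all symbols whose `j`-th coordinate is `l`. The `j`-th side
length drops by one, and old `j`-th coordinates larger than `l` are renumbered, so that the new
coordinate `x` comes from the old coordinate `x` if `x < l`, and from `x + 1` if `l ≤ x`. -/
def restrict {q d : ℕ} {n : Fin d → ℕ} (A : DArray q n) (j : Fin d) (l : Fin (n j)) :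
    DArray q (Function.update n j (n j - 1)) :=
  fun i => A fun t =>
    ⟨if t = j ∧ (l : ℕ) ≤ (i t : ℕ) then (i t : ℕ) + 1 else (i t : ℕ), by
      have h := (i t).isLt
      by_cases ht : t = j
      · subst ht
        have h2 : ((i t : ℕ)) < n t - 1 := by simpa using h
        split_ifs <;> omega
      · simpa [ht, Function.update_of_ne ht] using h⟩

/-- `A.Contains B`: the array `B` can be obtained from `A` by finitely many (possibly zero)
successive coordinate restrictions. -/
inductive Contains {q d : ℕ} :
    {n m : Fin d → ℕ} → DArray q n → DArray q m → Prop
  | refl {n : Fin d → ℕ} (A : DArray q n) : Contains A A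
  | step {n m : Fin d → ℕ} (A : DArray q n) (B : DArray q m) (j : Fin d) (l : Fin (n j)) :
      Contains (A.restrict j l) B → Contains A B

/-- `A` is `k`-universal: it contains every array over the same alphabet all of whose side
lengths are at most `k`. -/
def IsUniversal {q d : ℕ} {n : Fin d → ℕ} (k : ℕ) (A : DArray q n) : Prop :=
  ∀ (m : Fin d → ℕ), (∀ j, m j ≤ k) → ∀ B : DArray q m, A.Contains B

/-- The set of all `n` for which some `d`-array of order `n` (size `(n, …, n)`) over the
`q`-symbol alphabet is `k`-universal. -/
def universalOrders (d q k : ℕ) : Set ℕ :=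
  {n | ∃ A : DArray q (fun _ : Fin d => n), A.IsUniversal k}

/-- `f_d(q, k)`: the least order of a `k`-universal `d`-array over the `q`-symbol alphabet. -/
noncomputable def minUniversalOrder (d q k : ℕ) : ℕ :=
  sInf (universalOrders d q k)

end DArray

/-!
An array contains another one iff strictly increasing maps, one in each coordinate, cut it out.
An array of order `n` thus contains at most `C(n, k) ^ d ≤ (e n / k) ^ (k d)` arrays of order `k`,
and there are `q ^ (k ^ d)` of them, which gives the lower bound.

For the upper bound take a uniformly random array of order `n`. The events that the maps `φ` cut out
a copy of a fixed array `B` prescribe letters, so they are not increasing events of independent bits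
and Janson's inequality does not apply to them. Replace each uniform letter by `q` independent bits
of probability `1 / q`: since `1 - |W| / q ≤ (1 - 1 / q) ^ |W|`, this only raises the probability
of avoiding a set `W` of letters, hence, position by position, that of avoiding all copies of `B`.
The extended Janson inequality now bounds this probability by `exp (-1 / (2 G ^ d))` with
`G = ∑ s ∈ [1, k], C(k, s) ^ 2 / C(n, s) * q ^ (s ^ d / d)`, where two copies of `B` overlapping in
`s₁, …, s_d` values of the coordinates cost `q ^ (s₁ ⋯ s_d)` and AM-GM,
`s₁ ⋯ s_d ≤ ∑ j, s_j ^ d / d`, decouples the coordinates. Once `n` exceeds the asserted order by a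
factor `1 + ε`, `G` is exponentially small in `k`, and the union bound over all `B` concludes.
-/

namespace DArray

section Containment

variable {q d : ℕ} {n m : Fin d → ℕ}

/-- The subarray of `A` cut out by increasing coordinate maps `φ j : [m_j] → [n_j]`. -/
def subarray (A : DArray q n) (φ : ∀ j, Fin (m j) ↪o Fin (n j)) : DArray q m :=
  fun i => A fun j => φ j (i j)

/-- The renumbering of coordinates behind `DArray.restrict`: in direction `j` it is the increasing
map that omits `l`, in the other directions it is the identity. -/
def skip (j : Fin d) (l : Fin (n j)) (t : Fin d) :
    Fin (Function.update n j (n j - 1) t) ↪o Fin (n t) :=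
  OrderEmbedding.ofStrictMono
    (fun x => ⟨if t = j ∧ (l : ℕ) ≤ (x : ℕ) then (x : ℕ) + 1 else (x : ℕ), by
      have hx := x.isLt
      by_cases ht : t = j
      · subst ht
        simp only [Function.update_self] at hx
        split_ifs <;> omega
      · simpa [ht, Function.update_of_ne ht] using hx⟩)
    (fun x y hxy => by
      have : (x : ℕ) < y := hxy
      simp only [Fin.mk_lt_mk]
      split_ifs <;> omega)

theorem restrict_eq_subarray (A : DArray q n) (j : Fin d) (l : Fin (n j)) :
    A.restrict j l = A.subarray (skip j l) :=
  rfl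

theorem subarray_subarray {k : Fin d → ℕ} (A : DArray q n) (φ : ∀ j, Fin (m j) ↪o Fin (n j))
    (ψ : ∀ j, Fin (k j) ↪o Fin (m j)) :
    (A.subarray φ).subarray ψ = A.subarray fun j => (ψ j).trans (φ j) :=
  rfl

theorem exists_skip_eq {j : Fin d} {l : Fin (n j)} {t : Fin d} {y : Fin (n t)}
    (hy : t = j → (y : ℕ) ≠ l) : ∃ x, skip j l t x = y := by
  by_cases ht : t = j
  · subst ht
    have hyl := hy rfl
    refine ⟨⟨if (l : ℕ) < y then (y : ℕ) - 1 else (y : ℕ), ?_⟩, Fin.ext ?_⟩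
    · simp only [Function.update_self]
      split_ifs <;> omega
    · simp only [skip, OrderEmbedding.coe_ofStrictMono, true_and]
      split_ifs <;> omega
  · exact ⟨⟨y, by simp [ht]⟩, Fin.ext (by simp [skip, ht])⟩

theorem exists_skip_comp_eq {j : Fin d} {l : Fin (n j)} (φ : ∀ t, Fin (m t) ↪o Fin (n t))
    (hl : ∀ x, φ j x ≠ l) :
    ∃ ψ : ∀ t, Fin (m t) ↪o Fin (Function.update n j (n j - 1) t),
      (fun t => (ψ t).trans (skip j l t)) = φ := by
  have hmiss : ∀ t x, t = j → (φ t x : ℕ) ≠ l := by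
    rintro t x rfl h
    exact hl x (Fin.ext h)
  choose ψ hψ using fun t x => exists_skip_eq (hmiss t x)
  refine ⟨fun t => OrderEmbedding.ofMapLEIff (ψ t) fun x y => ?_, ?_⟩
  · rw [← (skip j l t).le_iff_le, hψ, hψ, (φ t).le_iff_le]
  · ext t x
    exact congrArg Fin.val (hψ t x)

theorem contains_subarray (A : DArray q n) (φ : ∀ j, Fin (m j) ↪o Fin (n j)) :
    A.Contains (A.subarray φ) := by
  induction hN : ∑ j, n j using Nat.strong_induction_on generalizing n with
  | _ N ih =>
    by_cases hφ : ∀ j, Function.Surjective (φ j)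
    · obtain rfl : m = n := funext fun j =>
        Fin.equiv_iff_eq.1 ⟨Equiv.ofBijective (φ j) ⟨(φ j).injective, hφ j⟩⟩
      obtain rfl : φ = fun j => RelEmbedding.refl _ := funext fun j =>
        DFunLike.coe_injective <| ((φ j).strictMono.range_inj strictMono_id).1 <| by
          simpa using (hφ j).range_eq
      exact Contains.refl A
    · simp only [Function.Surjective, not_forall, not_exists] at hφ
      obtain ⟨j, l, hl⟩ := hφ
      obtain ⟨ψ, rfl⟩ := exists_skip_comp_eq φ hl
      refine Contains.step A _ j l (ih _ ?_ (A.restrict j l) ψ rfl)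
      rw [← hN]
      refine Finset.sum_lt_sum (fun t _ => ?_) ⟨j, Finset.mem_univ j, ?_⟩
      · rcases eq_or_ne t j with rfl | ht <;> simp [*]
      · simpa using l.pos

theorem contains_iff {A : DArray q n} {B : DArray q m} :
    A.Contains B ↔ ∃ φ : ∀ j, Fin (m j) ↪o Fin (n j), A.subarray φ = B := by
  refine ⟨fun h => ?_, fun ⟨φ, hφ⟩ => hφ ▸ contains_subarray A φ⟩
  induction h with
  | refl A => exact ⟨fun j => RelEmbedding.refl _, rfl⟩
  | step A B j l _ ih =>
    obtain ⟨φ, rfl⟩ := ih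
    exact ⟨fun t => (φ t).trans (skip j l t), by rw [restrict_eq_subarray, subarray_subarray]⟩

theorem isUniversal_of_forall_order (hq : 0 < q) {k : ℕ} {A : DArray q n}
    (h : ∀ B : DArray q fun _ : Fin d => k, A.Contains B) : A.IsUniversal k := by
  intro m hm B
  obtain ⟨φ, hφ⟩ := contains_iff.1
    (h fun i => if hi : ∀ j, (i j : ℕ) < m j then B fun j => ⟨i j, hi j⟩ else ⟨0, hq⟩)
  refine contains_iff.2 ⟨fun j => (Fin.castLEOrderEmb (hm j)).trans (φ j), ?_⟩
  rw [← subarray_subarray, hφ]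
  funext i
  simp [subarray]

theorem universalOrders_anti (d q : ℕ) : Antitone (universalOrders d q) :=
  fun _ _ h _ ⟨A, hA⟩ => ⟨A, fun m hm B => hA m (fun j => (hm j).trans h) B⟩

end Containment

end DArray

theorem card_fin_orderEmbedding_fin (k n : ℕ) : Fintype.card (Fin k ↪o Fin n) = n.choose k := by
  rw [← Nat.card_eq_fintype_card, Nat.card_congr Set.powersetCard.ofFinEmbEquiv,
    Set.powersetCard.card, Nat.card_fin]

namespace DArray

theorem IsUniversal.pow_le_choose_pow {q d n k : ℕ} {A : DArray q fun _ : Fin d => n}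
    (hA : A.IsUniversal k) : q ^ k ^ d ≤ n.choose k ^ d := by
  let F : (Fin d → Fin k ↪o Fin n) → (Fin d → Fin k) → Fin q := A.subarray
  have hF : Function.Surjective F := fun B =>
    contains_iff.1 (hA (fun _ => k) (fun _ => le_rfl) B)
  simpa [card_fin_orderEmbedding_fin] using Fintype.card_le_of_surjective F hF

end DArray

section ProductExpectation

variable {C γ : Type*} [Fintype C] [DecidableEq C] [Fintype γ] {u u' : C → γ → ℝ}

/-- The expectation functional of a word `y : C → γ` whose letters are independent, the letter at
`c` having the distribution `u c`. The weights are arbitrary reals, so that `prodExp u` is merely a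
linear functional until they are assumed to be nonnegative with sum `1`. -/
noncomputable def prodExp (u : C → γ → ℝ) : ((C → γ) → ℝ) →ₗ[ℝ] ℝ :=
  ∑ y, (∏ c, u c (y c)) • LinearMap.proj y

theorem prodExp_apply (u : C → γ → ℝ) (F : (C → γ) → ℝ) :
    prodExp u F = ∑ y, (∏ c, u c (y c)) * F y := by
  simp [prodExp]

theorem prodExp_prod (u h : C → γ → ℝ) :
    prodExp u (fun y => ∏ c, h c (y c)) = ∏ c, ∑ g, u c g * h c g := by
  simp only [prodExp_apply, ← Finset.prod_mul_distrib, Fintype.prod_sum]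

theorem prodExp_const (hu : ∀ c, ∑ g, u c g = 1) (a : ℝ) : prodExp u (fun _ => a) = a := by
  have hone : prodExp u (fun _ => 1) = 1 := by simpa [hu] using prodExp_prod u fun _ _ => 1
  simpa [Pi.smul_def, hone] using map_smul (prodExp u) a fun _ => 1

theorem prodExp_mono (hu : ∀ c g, 0 ≤ u c g) : Monotone (prodExp u) := fun F G h => by
  simp only [prodExp_apply]
  gcongr with y
  · exact Finset.prod_nonneg fun c _ => hu c (y c)
  · exact h y

theorem prodExp_nonneg (hu : ∀ c g, 0 ≤ u c g) {F : (C → γ) → ℝ} (hF : 0 ≤ F) :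
    0 ≤ prodExp u F := by
  simpa using prodExp_mono hu hF

theorem exists_lt_of_prodExp_lt (hu : ∀ c g, 0 ≤ u c g) (hu1 : ∀ c, ∑ g, u c g = 1)
    {F : (C → γ) → ℝ} {a : ℝ} (h : prodExp u F < a) : ∃ y, F y < a := by
  by_contra! hF
  exact h.not_ge <| (prodExp_const hu1 a).symm.trans_le (prodExp_mono hu hF)

theorem prodExp_map {δ : Type*} [Fintype δ] [DecidableEq δ] (u : C → γ → ℝ) (f : γ → δ)
    (F : (C → δ) → ℝ) :
    prodExp u (fun y => F (f ∘ y)) = prodExp (fun c b => ∑ g with f g = b, u c g) F := by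
  simp only [prodExp_apply, Finset.prod_univ_sum, Finset.sum_mul]
  rw [← Finset.sum_fiberwise (g := (f ∘ ·))]
  refine Finset.sum_congr rfl fun z _ => Finset.sum_congr ?_ fun y hy => ?_
  · ext y
    simp [funext_iff]
  · rw [← (by simpa [funext_iff] using hy : f ∘ y = z)]

theorem prodExp_eq_sum_sum (u : C → γ → ℝ) (F : (C → γ) → ℝ) (c : C) :
    prodExp u F = ∑ z : {j // j ≠ c} → γ, (∏ j : {j // j ≠ c}, u j (z j)) *
      ∑ g, u c g * F ((Equiv.funSplitAt c γ).symm (g, z)) := by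
  rw [prodExp_apply, ← (Equiv.funSplitAt c γ).symm.sum_comp, Fintype.sum_prod_type_right]
  refine Finset.sum_congr rfl fun z _ => ?_
  rw [Finset.mul_sum]
  refine Finset.sum_congr rfl fun g _ => ?_
  have hprod : ∏ j : {j // j ≠ c}, u j ((Equiv.funSplitAt c γ).symm (g, z) j) =
      ∏ j : {j // j ≠ c}, u j (z j) :=
    Finset.prod_congr rfl fun j _ => by simp [j.2]
  rw [Fintype.prod_eq_mul_prod_subtype_ne _ c, hprod]
  simp only [Equiv.funSplitAt_symm_apply, dite_true]
  ring

theorem prodExp_eq_prodExp_update (u : C → γ → ℝ) (F : (C → γ) → ℝ) (c : C) {w : γ → ℝ}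
    (hw : ∑ g, w g = 1) :
    prodExp u F = prodExp (Function.update u c w)
      fun y => ∑ g, u c g * F (Function.update y c g) := by
  have hupd : ∀ a z g, Function.update ((Equiv.funSplitAt c γ).symm (a, z)) c g =
      (Equiv.funSplitAt c γ).symm (g, z) := by
    intro a z g
    ext j
    by_cases hj : j = c <;> simp [hj]
  have hprod : ∀ z : {j // j ≠ c} → γ,
      ∏ j : {j // j ≠ c}, Function.update u c w j (z j) = ∏ j : {j // j ≠ c}, u j (z j) :=
    fun z => Finset.prod_congr rfl fun j _ => by rw [Function.update_of_ne j.2]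
  simp only [prodExp_eq_sum_sum _ _ c, hupd, hprod, Function.update_self, ← Finset.sum_mul, hw,
    one_mul]

theorem prodExp_le_prodExp_update (hu : ∀ c g, 0 ≤ u c g) {c : C} (hc : ∑ g, u c g = 1)
    {w : γ → ℝ} {F : (C → γ) → ℝ}
    (h : ∀ y, ∑ g, u c g * F (Function.update y c g) ≤ ∑ g, w g * F (Function.update y c g)) :
    prodExp u F ≤ prodExp (Function.update u c w) F :=
  calc prodExp u F = prodExp u fun y => ∑ g, u c g * F (Function.update y c g) := by
        simpa using prodExp_eq_prodExp_update u F c hc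
    _ ≤ prodExp u fun y => ∑ g, w g * F (Function.update y c g) := prodExp_mono hu h
    _ = prodExp (Function.update u c w) F := by
        simpa using (prodExp_eq_prodExp_update (Function.update u c w) F c hc).symm

theorem prodExp_le_prodExp_of_forall_coord (hu : ∀ c g, 0 ≤ u c g) (hu1 : ∀ c, ∑ g, u c g = 1)
    (hu' : ∀ c g, 0 ≤ u' c g) {F : (C → γ) → ℝ}
    (h : ∀ c y, ∑ g, u c g * F (Function.update y c g) ≤
      ∑ g, u' c g * F (Function.update y c g)) : prodExp u F ≤ prodExp u' F := by
  suffices key : ∀ S : Finset C, prodExp u F ≤ prodExp (S.piecewise u' u) F by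
    simpa using key Finset.univ
  intro S
  induction S using Finset.induction_on with
  | empty => simp
  | insert c S hc ih =>
    rw [Finset.piecewise_insert]
    refine ih.trans (prodExp_le_prodExp_update (fun j g => ?_) ?_ fun y => ?_)
    · by_cases hj : j ∈ S <;> simp [hj, hu, hu']
    · simpa [hc] using hu1 c
    · simpa [hc] using h c y

end ProductExpectation

section Janson

theorem one_sub_sum_le_prod_one_sub {ι : Type*} {T : Finset ι} {x : ι → ℝ}
    (hx : ∀ i ∈ T, x i ∈ Set.Icc (0 : ℝ) 1) : 1 - ∑ i ∈ T, x i ≤ ∏ i ∈ T, (1 - x i) := by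
  induction T using Finset.cons_induction with
  | empty => simp
  | cons i T hi ih =>
    rw [Finset.forall_mem_cons] at hx
    have hsum : 0 ≤ ∑ j ∈ T, x j := Finset.sum_nonneg fun j hj => (hx.2 j hj).1
    rw [Finset.sum_cons, Finset.prod_cons]
    nlinarith [mul_le_mul_of_nonneg_left (ih hx.2) (sub_nonneg.2 hx.1.2),
      mul_nonneg hx.1.1 hsum]

variable {β ι : Type*}

/-- The weights of the Bernoulli distribution with parameter `p`. -/
def bernoulliWeight (p : ℝ) (b : Bool) : ℝ :=
  if b then p else 1 - p

theorem bernoulliWeight_nonneg {p : ℝ} (hp : p ∈ Set.Icc (0 : ℝ) 1) (b : Bool) :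
    0 ≤ bernoulliWeight p b := by
  cases b <;> simp [bernoulliWeight, hp.1, hp.2]

theorem sum_bernoulliWeight (p : ℝ) : ∑ b, bernoulliWeight p b = 1 := by
  simp [bernoulliWeight]

/-- The indicator of the event that all bits in `s` are set. -/
def allTrue (s : Finset β) (y : β → Bool) : ℝ :=
  if ∀ b ∈ s, y b = true then 1 else 0

/-- The indicator of the event that for no `i ∈ T` all bits in `s i` are set. -/
def noneTrue (s : ι → Finset β) (T : Finset ι) (y : β → Bool) : ℝ :=
  ∏ i ∈ T, (1 - allTrue (s i) y)

theorem allTrue_mem_Icc (s : Finset β) (y : β → Bool) : allTrue s y ∈ Set.Icc (0 : ℝ) 1 := by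
  unfold allTrue
  split_ifs <;> simp

theorem allTrue_monotone (s : Finset β) : Monotone (allTrue s) := by
  intro y z hyz
  by_cases hy : ∀ b ∈ s, y b = true
  · have hz : ∀ b ∈ s, z b = true := fun b hb => Bool.eq_true_of_true_le (hy b hb ▸ hyz b)
    rw [allTrue, allTrue, if_pos hy, if_pos hz]
  · rw [allTrue, if_neg hy]
    exact (allTrue_mem_Icc s z).1

theorem allTrue_mul_allTrue [DecidableEq β] (s t : Finset β) (y : β → Bool) :
    allTrue s y * allTrue t y = allTrue (s ∪ t) y := by
  simp only [allTrue, ite_zero_mul_ite_zero, Finset.forall_mem_union, mul_one]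

theorem allTrue_update_of_notMem [DecidableEq β] {s : Finset β} {b : β} (hb : b ∉ s)
    (y : β → Bool) (g : Bool) : allTrue s (Function.update y b g) = allTrue s y := by
  have h : ∀ c ∈ s, Function.update y b g c = y c := fun c hc =>
    Function.update_of_ne (ne_of_mem_of_not_mem hc hb) g y
  simp +contextual only [allTrue, h]

theorem noneTrue_mem_Icc (s : ι → Finset β) (T : Finset ι) (y : β → Bool) :
    noneTrue s T y ∈ Set.Icc (0 : ℝ) 1 :=
  ⟨Finset.prod_nonneg fun i _ => sub_nonneg.2 (allTrue_mem_Icc (s i) y).2,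
    Finset.prod_le_one (fun i _ => sub_nonneg.2 (allTrue_mem_Icc (s i) y).2) fun i _ =>
      sub_le_self 1 (allTrue_mem_Icc (s i) y).1⟩

theorem noneTrue_antitone (s : ι → Finset β) (T : Finset ι) : Antitone (noneTrue s T) :=
  fun _ z hyz => Finset.prod_le_prod (fun i _ => sub_nonneg.2 (allTrue_mem_Icc (s i) z).2)
    fun i _ => sub_le_sub_left (allTrue_monotone (s i) hyz) 1

theorem noneTrue_filter_mul_filter_not (s : ι → Finset β) (T : Finset ι) (P : ι → Prop)
    [DecidablePred P] :
    noneTrue s (T.filter P) * noneTrue s (T.filter fun i => ¬ P i) = noneTrue s T :=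
  funext fun _ => Finset.prod_filter_mul_prod_filter_not T P _

theorem noneTrue_le_of_subset (s : ι → Finset β) {T T' : Finset ι} (h : T ⊆ T') :
    noneTrue s T' ≤ noneTrue s T := fun y =>
  Finset.prod_le_prod_of_subset_of_le_one h
    (fun i _ => sub_nonneg.2 (allTrue_mem_Icc (s i) y).2)
    fun i _ _ => sub_le_self 1 (allTrue_mem_Icc (s i) y).1

theorem noneTrue_insert [DecidableEq ι] (s : ι → Finset β) {T : Finset ι} {i : ι} (hi : i ∉ T) :
    noneTrue s (insert i T) = noneTrue s T - allTrue (s i) * noneTrue s T := by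
  ext y
  simp only [noneTrue, Finset.prod_insert hi, Pi.sub_apply, Pi.mul_apply]
  ring

variable [DecidableEq β] {p : β → ℝ}

/-- The summand of Janson's dependency sum belonging to two sets of bits: the probability that all
their bits are set, counted only if the sets share a bit. -/
def overlapProb (p : β → ℝ) (s t : Finset β) : ℝ :=
  if Disjoint s t then 0 else ∏ b ∈ s ∪ t, p b

theorem overlapProb_comm (p : β → ℝ) (s t : Finset β) : overlapProb p s t = overlapProb p t s := by
  simp only [overlapProb, disjoint_comm, Finset.union_comm]

theorem overlapProb_self (p : β → ℝ) {s : Finset β} (hs : s.Nonempty) :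
    overlapProb p s s = ∏ b ∈ s, p b := by
  simp [overlapProb, hs.ne_empty]

theorem overlapProb_nonneg (hp : ∀ b, p b ∈ Set.Icc (0 : ℝ) 1) (s t : Finset β) :
    0 ≤ overlapProb p s t := by
  unfold overlapProb
  split_ifs
  exacts [le_rfl, Finset.prod_nonneg fun b _ => (hp b).1]

-- The factors of `noneTrue s T` which overlap `s i` are bounded below by the Weierstrass product
-- inequality, the others are left alone.
theorem allTrue_mul_noneTrue_ge (s : ι → Finset β) (T : Finset ι) (i : ι) :
    allTrue (s i) * noneTrue s {j ∈ T | Disjoint (s i) (s j)} -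
      ∑ j ∈ T with ¬ Disjoint (s i) (s j),
        allTrue (s i ∪ s j) * noneTrue s {j ∈ T | Disjoint (s i) (s j)} ≤
      allTrue (s i) * noneTrue s T := by
  rw [← noneTrue_filter_mul_filter_not s T fun j => Disjoint (s i) (s j)]
  intro y
  have hweier := one_sub_sum_le_prod_one_sub (T := {j ∈ T | ¬ Disjoint (s i) (s j)})
    fun j _ => allTrue_mem_Icc (s j) y
  have h := mul_le_mul_of_nonneg_left hweier <| mul_nonneg (allTrue_mem_Icc (s i) y).1
    (noneTrue_mem_Icc s {j ∈ T | Disjoint (s i) (s j)} y).1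
  refine le_trans (le_of_eq ?_) (h.trans_eq (mul_assoc _ _ _))
  simp only [Pi.sub_apply, Pi.mul_apply, Finset.sum_apply, ← allTrue_mul_allTrue, mul_sub,
    Finset.mul_sum, mul_one]
  exact congrArg _ (Finset.sum_congr rfl fun j _ => mul_right_comm _ _ _)

theorem sum_prod_le_sum_sum_overlapProb [Fintype ι] (hp : ∀ b, p b ∈ Set.Icc (0 : ℝ) 1)
    {s : ι → Finset β} (hs : ∀ i, (s i).Nonempty) :
    ∑ i, ∏ b ∈ s i, p b ≤ ∑ i, ∑ j, overlapProb p (s i) (s j) :=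
  Finset.sum_le_sum fun i _ => by
    rw [← overlapProb_self p (hs i)]
    exact Finset.single_le_sum (fun j _ => overlapProb_nonneg hp (s i) (s j)) (Finset.mem_univ i)

variable [Fintype β]

/-- The expectation functional of independent random bits, the bit at `b` being set with
probability `p b`. -/
noncomputable def bernoulliExp (p : β → ℝ) : ((β → Bool) → ℝ) →ₗ[ℝ] ℝ :=
  prodExp fun b => bernoulliWeight (p b)

theorem bernoulliExp_const (p : β → ℝ) (a : ℝ) : bernoulliExp p (fun _ => a) = a :=
  prodExp_const (fun b => sum_bernoulliWeight (p b)) a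

theorem bernoulliExp_mono (hp : ∀ b, p b ∈ Set.Icc (0 : ℝ) 1) : Monotone (bernoulliExp p) :=
  prodExp_mono fun b => bernoulliWeight_nonneg (hp b)

theorem bernoulliExp_nonneg (hp : ∀ b, p b ∈ Set.Icc (0 : ℝ) 1) {F : (β → Bool) → ℝ}
    (hF : 0 ≤ F) : 0 ≤ bernoulliExp p F :=
  prodExp_nonneg (fun b => bernoulliWeight_nonneg (hp b)) hF

theorem bernoulliExp_allTrue_singleton_mul (p : β → ℝ) {b : β} {F : (β → Bool) → ℝ}
    (hF : ∀ y g, F (Function.update y b g) = F y) :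
    bernoulliExp p (allTrue {b} * F) = p b * bernoulliExp p F := by
  have hcol : ∀ y, ∑ g, bernoulliWeight (p b) g *
      (allTrue {b} * F) (Function.update y b g) = p b * F y := fun y => by
    simp [hF, allTrue, bernoulliWeight]
  have h := prodExp_eq_prodExp_update (fun b => bernoulliWeight (p b)) (allTrue {b} * F) b
    (sum_bernoulliWeight (p b))
  simp only [hcol, Function.update_eq_self] at h
  exact h.trans (map_smul (bernoulliExp p) (p b) F)

theorem bernoulliExp_allTrue_mul (p : β → ℝ) (s : Finset β) {F : (β → Bool) → ℝ}
    (hF : ∀ b ∈ s, ∀ y g, F (Function.update y b g) = F y) :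
    bernoulliExp p (allTrue s * F) = (∏ b ∈ s, p b) * bernoulliExp p F := by
  induction s using Finset.induction_on with
  | empty => simp [show allTrue (∅ : Finset β) = 1 from funext fun y => by simp [allTrue]]
  | insert b s hb ih =>
    rw [Finset.forall_mem_insert] at hF
    have hsplit : allTrue (insert b s) * F = allTrue {b} * (allTrue s * F) := by
      rw [← mul_assoc]
      ext y
      simp [allTrue_mul_allTrue]
    rw [hsplit, bernoulliExp_allTrue_singleton_mul, ih hF.2, Finset.prod_insert hb, mul_assoc]
    intro y g
    simp [allTrue_update_of_notMem hb, hF.1]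

theorem bernoulliExp_allTrue (p : β → ℝ) (s : Finset β) :
    bernoulliExp p (allTrue s) = ∏ b ∈ s, p b := by
  have h := bernoulliExp_allTrue_mul p s (F := fun _ => 1) fun _ _ _ _ => rfl
  rw [bernoulliExp_const, mul_one] at h
  rw [← h]
  congr 1
  ext y
  simp

-- Harris' inequality: the product measure is log-modular, so the FKG inequality applies to `f`
-- and the increasing function `1 - g`.
theorem bernoulliExp_mul_le (hp : ∀ b, p b ∈ Set.Icc (0 : ℝ) 1) {f g : (β → Bool) → ℝ}
    (hf0 : 0 ≤ f) (hf : Monotone f) (hg1 : g ≤ 1) (hg : Antitone g) :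
    bernoulliExp p (f * g) ≤ bernoulliExp p f * bernoulliExp p g := by
  set μ : (β → Bool) → ℝ := fun y => ∏ b, bernoulliWeight (p b) (y b) with hμ
  have hexp : ∀ F, ∑ y, μ y * F y = bernoulliExp p F := fun F => (prodExp_apply _ F).symm
  have hfkg := fkg (μ := μ) (f := f) (g := 1 - g)
    (fun y => Finset.prod_nonneg fun b _ => bernoulliWeight_nonneg (hp b) (y b)) hf0
    (sub_nonneg.2 hg1) hf (fun y z hyz => sub_le_sub_left (hg hyz) 1) fun y z => by
      simp only [hμ, ← Finset.prod_mul_distrib]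
      refine (Finset.prod_congr rfl fun b _ => ?_).le
      cases hy : y b <;> cases hz : z b <;> simp [hy, hz, mul_comm]
  have hone : ∑ y, μ y = 1 := by simpa using (hexp fun _ => 1).trans (bernoulliExp_const p 1)
  have hsub : bernoulliExp p (1 - g) = 1 - bernoulliExp p g := by
    rw [map_sub]
    exact congrArg (· - _) (bernoulliExp_const p 1)
  rw [hone, one_mul, hexp, hexp, hsub] at hfkg
  have hmul : ∑ y, μ y * (f y * (1 - g) y) = bernoulliExp p f - bernoulliExp p (f * g) := by
    rw [← map_sub, ← hexp]
    simp [mul_sub]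
  linarith

theorem bernoulliExp_noneTrue_nonneg (hp : ∀ b, p b ∈ Set.Icc (0 : ℝ) 1) (s : ι → Finset β)
    (T : Finset ι) : 0 ≤ bernoulliExp p (noneTrue s T) :=
  bernoulliExp_nonneg hp fun y => (noneTrue_mem_Icc s T y).1

theorem bernoulliExp_allTrue_mul_noneTrue_ge (hp : ∀ b, p b ∈ Set.Icc (0 : ℝ) 1)
    (s : ι → Finset β) (T : Finset ι) (i : ι) :
    (∏ b ∈ s i, p b - ∑ j ∈ T, overlapProb p (s i) (s j)) *
        bernoulliExp p (noneTrue s {j ∈ T | Disjoint (s i) (s j)}) ≤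
      bernoulliExp p (allTrue (s i) * noneTrue s T) := by
  set T₀ := {j ∈ T | Disjoint (s i) (s j)}
  have hindep : bernoulliExp p (allTrue (s i) * noneTrue s T₀) =
      (∏ b ∈ s i, p b) * bernoulliExp p (noneTrue s T₀) := by
    refine bernoulliExp_allTrue_mul p _ fun b hb y g => Finset.prod_congr rfl fun j hj => ?_
    rw [allTrue_update_of_notMem (Finset.disjoint_left.1 (Finset.mem_filter.1 hj).2 hb)]
  have hharris : ∀ j, bernoulliExp p (allTrue (s i ∪ s j) * noneTrue s T₀) ≤
      (∏ b ∈ s i ∪ s j, p b) * bernoulliExp p (noneTrue s T₀) := fun j => by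
    rw [← bernoulliExp_allTrue]
    exact bernoulliExp_mul_le hp (fun y => (allTrue_mem_Icc _ y).1) (allTrue_monotone _)
      (fun y => (noneTrue_mem_Icc s T₀ y).2) (noneTrue_antitone s T₀)
  have hge := bernoulliExp_mono hp (allTrue_mul_noneTrue_ge s T i)
  rw [map_sub, map_sum, hindep] at hge
  have hsum : ∑ j ∈ T, overlapProb p (s i) (s j) =
      ∑ j ∈ T with ¬ Disjoint (s i) (s j), ∏ b ∈ s i ∪ s j, p b := by
    simp only [overlapProb, Finset.sum_filter, ite_not]
  rw [sub_mul, hsum, Finset.sum_mul]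
  exact (sub_le_sub_left (Finset.sum_le_sum fun j _ => hharris j) _).trans hge

theorem bernoulliExp_noneTrue_insert_le [DecidableEq ι] (hp : ∀ b, p b ∈ Set.Icc (0 : ℝ) 1)
    (s : ι → Finset β) {T : Finset ι} {i : ι} (hi : i ∉ T) :
    bernoulliExp p (noneTrue s (insert i T)) ≤ bernoulliExp p (noneTrue s T) *
      (1 - (∏ b ∈ s i, p b - ∑ j ∈ T, overlapProb p (s i) (s j))) := by
  rw [noneTrue_insert s hi, map_sub]
  set δ := ∏ b ∈ s i, p b - ∑ j ∈ T, overlapProb p (s i) (s j)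
  suffices h : δ * bernoulliExp p (noneTrue s T) ≤
      bernoulliExp p (allTrue (s i) * noneTrue s T) by linarith
  rcases le_total 0 δ with hδ | hδ
  · have hmono := bernoulliExp_mono hp (noneTrue_le_of_subset s
      (Finset.filter_subset (fun j => Disjoint (s i) (s j)) T))
    exact (mul_le_mul_of_nonneg_left hmono hδ).trans
      (bernoulliExp_allTrue_mul_noneTrue_ge hp s T i)
  · exact (mul_nonpos_of_nonpos_of_nonneg hδ (bernoulliExp_noneTrue_nonneg hp s T)).trans <|
      bernoulliExp_nonneg hp fun y =>
        mul_nonneg (allTrue_mem_Icc (s i) y).1 (noneTrue_mem_Icc s T y).1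

theorem sum_offDiag_insert [DecidableEq ι] {c : ι → ι → ℝ} (hc : ∀ i j, c i j = c j i)
    {T : Finset ι} {i : ι} (hi : i ∉ T) :
    ∑ x ∈ (insert i T).offDiag, c x.1 x.2 =
      ∑ x ∈ T.offDiag, c x.1 x.2 + 2 * ∑ j ∈ T, c i j := by
  have h₁ : Disjoint T.offDiag ({i} ×ˢ T) := by
    rw [Finset.disjoint_left]; grind
  have h₂ : Disjoint (T.offDiag ∪ {i} ×ˢ T) (T ×ˢ {i}) := by
    rw [Finset.disjoint_left]; grind
  rw [Finset.offDiag_insert hi, Finset.sum_union h₂, Finset.sum_union h₁]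
  simp only [Finset.sum_product, Finset.sum_singleton, hc _ i]
  ring

/-- **Janson's inequality**; the ordered pairs in `T.offDiag` list each dependent pair twice. -/
theorem bernoulliExp_noneTrue_le_exp (hp : ∀ b, p b ∈ Set.Icc (0 : ℝ) 1) (s : ι → Finset β)
    (T : Finset ι) :
    bernoulliExp p (noneTrue s T) ≤ Real.exp (-∑ i ∈ T, ∏ b ∈ s i, p b +
      (∑ x ∈ T.offDiag, overlapProb p (s x.1) (s x.2)) / 2) := by
  classical
  induction T using Finset.induction_on with
  | empty =>
    rw [show noneTrue s ∅ = fun _ => 1 from funext fun y => Finset.prod_empty,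
      bernoulliExp_const]
    simp
  | insert i T hi ih =>
    calc bernoulliExp p (noneTrue s (insert i T))
        ≤ bernoulliExp p (noneTrue s T) *
            (1 - (∏ b ∈ s i, p b - ∑ j ∈ T, overlapProb p (s i) (s j))) :=
          bernoulliExp_noneTrue_insert_le hp s hi
      _ ≤ _ := mul_le_mul_of_nonneg ih (Real.one_sub_le_exp_neg _)
          (bernoulliExp_noneTrue_nonneg hp s T) (Real.exp_pos _).le
      _ = _ := ?_
    rw [← Real.exp_add, Finset.sum_insert hi,
      sum_offDiag_insert (fun i j => overlapProb_comm p (s i) (s j)) hi]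
    ring_nf

-- Average the hypothesis over a random set `T` containing each element with probability `r`.
theorem le_of_forall_finset_le [Fintype ι] {a : ι → ℝ} {c : ι → ι → ℝ} {L r : ℝ}
    (hr : r ∈ Set.Icc (0 : ℝ) 1)
    (h : ∀ T : Finset ι, L ≤ -∑ i ∈ T, a i + (∑ x ∈ T.offDiag, c x.1 x.2) / 2) :
    L ≤ -(r * ∑ i, a i) + r ^ 2 * (∑ x ∈ Finset.univ.offDiag, c x.1 x.2) / 2 := by
  classical
  let Φ : (ι → Bool) → ℝ := -∑ i, a i • allTrue {i} +
    (2⁻¹ : ℝ) • ∑ x ∈ Finset.univ.offDiag, c x.1 x.2 • allTrue {x.1, x.2}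
  have hΦ : (fun _ => L) ≤ Φ := by
    intro z
    refine (h {i | z i = true}).trans_eq ?_
    have hoff : (Finset.univ.filter fun i => z i = true).offDiag =
        Finset.univ.offDiag.filter fun x => z x.1 = true ∧ z x.2 = true := by
      ext x
      simp only [Finset.mem_offDiag, Finset.mem_filter, Finset.mem_univ, true_and]
      tauto
    simp [Φ, allTrue, hoff, Finset.sum_filter, div_eq_inv_mul]
  have hpair : ∀ x ∈ (Finset.univ : Finset ι).offDiag,
      c x.1 x.2 * ∏ _i ∈ {x.1, x.2}, r = r ^ 2 * c x.1 x.2 := fun x hx => by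
    rw [Finset.prod_pair (Finset.mem_offDiag.1 hx).2.2]
    ring
  calc L = bernoulliExp (fun _ : ι => r) fun _ => L := (bernoulliExp_const _ L).symm
    _ ≤ bernoulliExp (fun _ => r) Φ := bernoulliExp_mono (fun _ => hr) hΦ
    _ = _ := by
      simp only [Φ, map_add, map_neg, map_sum, map_smul, smul_eq_mul, bernoulliExp_allTrue]
      rw [Finset.sum_congr rfl hpair, ← Finset.mul_sum]
      simp only [Finset.prod_singleton, ← Finset.sum_mul]
      ring

theorem neg_div_mul_add_sq_mul_le {μ Δ O : ℝ} (h : O ≤ Δ) :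
    -(μ / Δ * μ) + (μ / Δ) ^ 2 * O / 2 ≤ -(μ ^ 2 / (2 * Δ)) :=
  calc _ ≤ -(μ / Δ * μ) + (μ / Δ) ^ 2 * Δ / 2 := by gcongr
    _ = _ := by
      rcases eq_or_ne Δ 0 with h0 | h0
      · simp [h0]
      · field_simp
        ring

/-- The **extended Janson inequality**, the dependent pairs including the diagonal. -/
theorem bernoulliExp_noneTrue_le_exp_neg_sq [Fintype ι] (hp : ∀ b, p b ∈ Set.Icc (0 : ℝ) 1)
    {s : ι → Finset β} (hs : ∀ i, (s i).Nonempty) :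
    bernoulliExp p (noneTrue s Finset.univ) ≤ Real.exp
      (-((∑ i, ∏ b ∈ s i, p b) ^ 2 / (2 * ∑ i, ∑ j, overlapProb p (s i) (s j)))) := by
  have hc : ∀ i j, 0 ≤ overlapProb p (s i) (s j) := fun i j => overlapProb_nonneg hp _ _
  have hμ : 0 ≤ ∑ i, ∏ b ∈ s i, p b :=
    Finset.sum_nonneg fun i _ => Finset.prod_nonneg fun b _ => (hp b).1
  have hμΔ := sum_prod_le_sum_sum_overlapProb hp hs
  have hoff : ∑ x ∈ Finset.univ.offDiag, overlapProb p (s x.1) (s x.2) ≤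
      ∑ i, ∑ j, overlapProb p (s i) (s j) := by
    rw [← Fintype.sum_prod_type' fun i j => overlapProb p (s i) (s j)]
    exact Finset.sum_le_univ_sum_of_nonneg fun x => hc x.1 x.2
  rcases le_or_gt (bernoulliExp p (noneTrue s Finset.univ)) 0 with hE | hE
  · exact hE.trans (Real.exp_pos _).le
  rw [← Real.log_le_iff_le_exp hE]
  -- The choice `r = μ / Δ` minimizes `-r μ + r² Δ / 2`.
  refine (le_of_forall_finset_le (c := fun i j => overlapProb p (s i) (s j))
    ⟨div_nonneg hμ (hμ.trans hμΔ), div_le_one_of_le₀ hμΔ (hμ.trans hμΔ)⟩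
    fun T => (Real.log_le_iff_le_exp hE).2 ?_).trans (neg_div_mul_add_sq_mul_le hoff)
  exact (bernoulliExp_mono hp (noneTrue_le_of_subset s (Finset.subset_univ T))).trans
    (bernoulliExp_noneTrue_le_exp hp s T)

end Janson

section LetterBits

variable {C Q ι : Type*}

/-- The one-hot encoding of a word: the bit at `(c, a)` tells whether position `c` carries `a`. -/
def letterBits [DecidableEq Q] (w : C → Q) : C × Q → Bool :=
  fun x => decide (w x.1 = x.2)

variable [DecidableEq C]

theorem allTrue_uncurry_update [DecidableEq Q] {s : Finset (C × Q)}
    (hs : Set.InjOn Prod.fst (s : Set (C × Q))) {c : C} {a : Q} (ha : (c, a) ∈ s)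
    (y : C → Q → Bool) (g : Q → Bool) :
    allTrue s (Function.uncurry (Function.update y c g)) =
      allTrue (s.erase (c, a)) (Function.uncurry y) * allTrue {a} g := by
  have hne : ∀ x ∈ s.erase (c, a), x.1 ≠ c := fun x hx hxc =>
    Finset.ne_of_mem_erase hx (hs (Finset.mem_of_mem_erase hx) ha hxc)
  have herase : ∀ x ∈ s.erase (c, a),
      Function.uncurry (Function.update y c g) x = Function.uncurry y x := fun x hx => by
    simp only [Function.uncurry, Function.update_of_ne (hne x hx)]
  have hcolumn : Function.uncurry (Function.update y c g) (c, a) = g a := by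
    simp only [Function.uncurry, Function.update_self]
  rw [mul_comm]
  conv_lhs => rw [← Finset.insert_erase ha]
  simp +contextual only [allTrue, Finset.forall_mem_insert, herase, hcolumn,
    Finset.mem_singleton, forall_eq, ite_zero_mul_ite_zero, mul_one]

theorem exists_one_sub_allTrue_update_eq {s : Finset (C × Q)}
    (hs : Set.InjOn Prod.fst (s : Set (C × Q))) (c : C) (y : C → Q → Bool) :
    ∃ κ : ℝ, 0 ≤ κ ∧ ∃ W : Finset Q, ∀ g,
      1 - allTrue s (Function.uncurry (Function.update y c g)) =
        κ * noneTrue (fun a => {a}) W g := by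
  classical
  by_cases hc : ∃ a, (c, a) ∈ s
  · obtain ⟨a, ha⟩ := hc
    refine ⟨1, zero_le_one, ?_⟩
    simp only [allTrue_uncurry_update hs ha, one_mul]
    by_cases hK : ∀ b ∈ s.erase (c, a), Function.uncurry y b = true
    · exact ⟨{a}, fun g => by rw [allTrue, if_pos hK, one_mul, noneTrue, Finset.prod_singleton]⟩
    · exact ⟨∅, fun g => by rw [allTrue, if_neg hK, zero_mul, sub_zero, noneTrue,
        Finset.prod_empty]⟩
  · refine ⟨_, sub_nonneg.2 (allTrue_mem_Icc s (Function.uncurry y)).2, ∅, fun g => ?_⟩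
    have hne : ∀ x ∈ s, Function.uncurry (Function.update y c g) x = Function.uncurry y x :=
      fun x hx => by
        have hxc : x.1 ≠ c := fun h => hc ⟨x.2, h ▸ hx⟩
        simp only [Function.uncurry, Function.update_of_ne hxc]
    simp +contextual only [allTrue, noneTrue, hne, Finset.prod_empty, mul_one]

theorem noneTrue_singleton (W : Finset Q) (g : Q → Bool) :
    noneTrue (fun a => {a}) W g = if ∀ a ∈ W, g a = false then 1 else 0 := by
  rw [← Finset.prod_boole]
  refine Finset.prod_congr rfl fun a _ => ?_
  cases h : g a <;> simp [allTrue, h]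

theorem exists_noneTrue_update_eq {t : ι → Finset (C × Q)} {T : Finset ι}
    (ht : ∀ i ∈ T, Set.InjOn Prod.fst (t i : Set (C × Q))) (c : C) (y : C → Q → Bool) :
    ∃ κ : ℝ, 0 ≤ κ ∧ ∃ W : Finset Q, ∀ g,
      noneTrue t T (Function.uncurry (Function.update y c g)) =
        κ * noneTrue (fun a => {a}) W g := by
  classical
  induction T using Finset.cons_induction with
  | empty => exact ⟨1, zero_le_one, ∅, fun g => by simp [noneTrue]⟩
  | cons i T hi ih =>
    rw [Finset.forall_mem_cons] at ht
    obtain ⟨κ, hκ, W, hW⟩ := ih ht.2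
    obtain ⟨κ', hκ', W', hW'⟩ := exists_one_sub_allTrue_update_eq ht.1 c y
    refine ⟨κ' * κ, mul_nonneg hκ' hκ, W' ∪ W, fun g => ?_⟩
    rw [noneTrue, Finset.prod_cons, hW', ← noneTrue, hW, mul_mul_mul_comm]
    simp only [noneTrue_singleton, Finset.forall_mem_union, ite_zero_mul_ite_zero, mul_one]

variable [Fintype Q] [DecidableEq Q]

theorem bernoulliExp_noneTrue_singleton (p : Q → ℝ) (W : Finset Q) :
    bernoulliExp p (noneTrue (fun a => {a}) W) = ∏ a ∈ W, (1 - p a) := by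
  induction W using Finset.induction_on with
  | empty =>
    rw [Finset.prod_empty, show noneTrue (fun a : Q => {a}) ∅ = fun _ => 1 from
      funext fun y => Finset.prod_empty, bernoulliExp_const]
  | insert a W ha ih =>
    rw [noneTrue_insert _ ha, map_sub, bernoulliExp_allTrue_singleton_mul, ih,
      Finset.prod_insert ha, one_sub_mul]
    refine fun y b => Finset.prod_congr rfl fun a' ha' => ?_
    rw [allTrue_update_of_notMem (Finset.notMem_singleton.2 (ne_of_mem_of_not_mem ha' ha).symm)]

theorem sum_mul_noneTrue_singleton_le {p : Q → ℝ} (hp : ∀ a, 0 ≤ p a) (hp1 : ∑ a, p a = 1)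
    (W : Finset Q) :
    ∑ a, p a * noneTrue (fun a => {a}) W (fun b => decide (a = b)) ≤
      bernoulliExp p (noneTrue (fun a => {a}) W) :=
  calc ∑ a, p a * noneTrue (fun a => {a}) W (fun b => decide (a = b))
      = 1 - ∑ a ∈ W, p a := by
        have hcompl : ∀ a, p a * noneTrue (fun a => {a}) W (fun b => decide (a = b)) =
            p a - if a ∈ W then p a else 0 := fun a => by
          rw [noneTrue_singleton]
          by_cases ha : a ∈ W <;> simp [ha]
        simp only [hcompl, Finset.sum_sub_distrib, hp1, Finset.sum_ite_mem, Finset.univ_inter]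
    _ ≤ ∏ a ∈ W, (1 - p a) := one_sub_sum_le_prod_one_sub fun a _ =>
        ⟨hp a, hp1 ▸ Finset.single_le_sum (fun b _ => hp b) (Finset.mem_univ a)⟩
    _ = bernoulliExp p (noneTrue (fun a => {a}) W) := (bernoulliExp_noneTrue_singleton p W).symm

variable [Fintype C]

theorem prodExp_uncurry {γ : Type*} [Fintype γ] (u : C × Q → γ → ℝ) (F : (C × Q → γ) → ℝ) :
    prodExp u F =
      prodExp (fun c g => ∏ a, u (c, a) (g a)) fun y => F (Function.uncurry y) := by
  simp only [prodExp_apply]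
  rw [← (Equiv.curry C Q γ).symm.sum_comp]
  exact Finset.sum_congr rfl fun y _ => by rw [Fintype.prod_prod_type]; rfl

theorem prodExp_noneTrue_letterBits_le {v : C → Q → ℝ} (hv : ∀ c a, 0 ≤ v c a)
    (hv1 : ∀ c, ∑ a, v c a = 1) {t : ι → Finset (C × Q)} {T : Finset ι}
    (ht : ∀ i ∈ T, Set.InjOn Prod.fst (t i : Set (C × Q))) :
    prodExp v (fun w => noneTrue t T (letterBits w)) ≤
      bernoulliExp (fun x => v x.1 x.2) (noneTrue t T) := by
  let oneHot : Q → Q → Bool := fun a b => decide (a = b)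
  have hv01 : ∀ c a, v c a ∈ Set.Icc (0 : ℝ) 1 := fun c a =>
    ⟨hv c a, hv1 c ▸ Finset.single_le_sum (fun b _ => hv c b) (Finset.mem_univ a)⟩
  rw [bernoulliExp, prodExp_uncurry]
  refine (prodExp_map v oneHot fun y => noneTrue t T (Function.uncurry y)).trans_le ?_
  refine prodExp_le_prodExp_of_forall_coord (fun c g => Finset.sum_nonneg fun a _ => hv c a)
    (fun c => (Finset.sum_fiberwise _ _ _).trans (hv1 c))
    (fun c g => Finset.prod_nonneg fun a _ => bernoulliWeight_nonneg (hv01 c a) (g a))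
    fun c y => ?_
  obtain ⟨κ, hκ, W, hW⟩ := exists_noneTrue_update_eq ht c y
  have hfiber : ∀ f : (Q → Bool) → ℝ,
      ∑ g, (∑ a with oneHot a = g, v c a) * f g = ∑ a, v c a * f (oneHot a) := fun f => by
    rw [← Finset.sum_fiberwise _ oneHot]
    refine Finset.sum_congr rfl fun g _ => ?_
    rw [Finset.sum_mul]
    exact Finset.sum_congr rfl fun a ha => by rw [(Finset.mem_filter.1 ha).2]
  have hcolumn := mul_le_mul_of_nonneg_left (sum_mul_noneTrue_singleton_le (hv c) (hv1 c) W) hκ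
  simp only [hW, hfiber]
  rw [bernoulliExp, prodExp_apply, Finset.mul_sum, Finset.mul_sum] at hcolumn
  simpa only [mul_left_comm κ] using hcolumn

end LetterBits

theorem exists_forall_eq_true_of_noneTrue_lt_one {β ι : Type*} {s : ι → Finset β} {T : Finset ι}
    {y : β → Bool} (h : noneTrue s T y < 1) : ∃ i ∈ T, ∀ b ∈ s i, y b = true := by
  by_contra! hT
  refine h.ne (Finset.prod_eq_one fun i hi => ?_)
  obtain ⟨b, hb, hy⟩ := hT i hi
  rw [allTrue, if_neg fun h => hy (h b hb), sub_zero]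

theorem prod_le_sum_pow_card_div_card {ι : Type*} [Fintype ι] [Nonempty ι] {x : ι → ℝ}
    (hx : 0 ≤ x) : ∏ i, x i ≤ ∑ i, x i ^ Fintype.card ι / Fintype.card ι := by
  have hι : (Fintype.card ι : ℝ) ≠ 0 := Nat.cast_ne_zero.2 Fintype.card_ne_zero
  have hamgm := Real.geom_mean_le_arith_mean_weighted Finset.univ
    (fun _ : ι => (Fintype.card ι : ℝ)⁻¹) (fun i => x i ^ Fintype.card ι)
    (fun _ _ => by positivity) (by simp [hι]) fun i _ => pow_nonneg (hx i) _
  simpa only [Real.pow_rpow_inv_natCast (hx _) Fintype.card_ne_zero, div_eq_inv_mul] using hamgm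

section Overlap

variable {d q k n : ℕ}

/-- The weight of a pair of coordinate maps with `s` common values in the second moment
computation. -/
noncomputable def overlapWeight (d q s : ℕ) : ℝ :=
  if s = 0 then 0 else (q : ℝ) ^ ((s : ℝ) ^ d / d)

/-- The second moment of the number of copies of a fixed array of order `k` in a random array of
order `n`, normalized by the square of the mean, is at most the `d`-th power of this number. -/
noncomputable def overlapSum (d q n k : ℕ) : ℝ :=
  ∑ s ∈ Finset.Icc 1 k, (k.choose s : ℝ) ^ 2 / n.choose s * (q : ℝ) ^ ((s : ℝ) ^ d / d)

/-- The number of common values of two coordinate maps. -/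
def overlap {m : ℕ} (φ : Fin k ↪o Fin n) (ψ : Fin m ↪o Fin n) : ℕ :=
  (Finset.univ.map φ.toEmbedding ∩ Finset.univ.map ψ.toEmbedding).card

theorem overlapWeight_nonneg (d q s : ℕ) : 0 ≤ overlapWeight d q s := by
  unfold overlapWeight
  split_ifs <;> positivity

theorem overlapSum_pos (hq : 0 < q) (hk : 0 < k) (hkn : k ≤ n) : 0 < overlapSum d q n k := by
  refine Finset.sum_pos (fun s hs => ?_) ⟨1, Finset.mem_Icc.2 ⟨le_rfl, hk⟩⟩
  have hsk := (Finset.mem_Icc.1 hs).2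
  have hks := Nat.choose_pos hsk
  have hns := Nat.choose_pos (hsk.trans hkn)
  positivity

theorem pow_prod_le_prod_overlapWeight (hd : 0 < d) (hq : 0 < q) {s : Fin d → ℕ}
    (hs : ∀ t, s t ≠ 0) : (q : ℝ) ^ ∏ t, s t ≤ ∏ t, overlapWeight d q (s t) := by
  have : Nonempty (Fin d) := ⟨⟨0, hd⟩⟩
  calc (q : ℝ) ^ ∏ t, s t ≤ (q : ℝ) ^ ∑ t, (s t : ℝ) ^ d / d := by
        rw [← Real.rpow_natCast, Nat.cast_prod]
        refine Real.rpow_le_rpow_of_exponent_le (Nat.one_le_cast.2 hq) ?_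
        simpa using prod_le_sum_pow_card_div_card fun t => Nat.cast_nonneg (α := ℝ) (s t)
    _ = ∏ t, overlapWeight d q (s t) := by
        simp only [Real.rpow_sum_of_pos (Nat.cast_pos.2 hq), overlapWeight, hs, if_false]

theorem card_filter_card_inter_eq_le {α : Type*} [Fintype α] [DecidableEq α] (a : Finset α)
    {k s : ℕ} (hs : s ≤ k) :
    ((Finset.univ.powersetCard k).filter fun b => (a ∩ b).card = s).card ≤
      a.card.choose s * (Fintype.card α - s).choose (k - s) := by
  have hsub : (Finset.univ.powersetCard k).filter (fun b => (a ∩ b).card = s) ⊆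
      (a.powersetCard s).biUnion fun c => (Finset.univ.powersetCard k).filter (c ⊆ ·) :=
    fun b hb => by
      rw [Finset.mem_filter] at hb
      exact Finset.mem_biUnion.2 ⟨a ∩ b, Finset.mem_powersetCard.2 ⟨Finset.inter_subset_left, hb.2⟩,
        Finset.mem_filter.2 ⟨hb.1, Finset.inter_subset_right⟩⟩
  rw [← Finset.card_powersetCard]
  refine (Finset.card_le_card hsub).trans (Finset.card_biUnion_le_card_mul _ _ _ fun c hc => ?_)
  have hcs := (Finset.mem_powersetCard.1 hc).2
  rw [Finset.card_filter_powersetCard_subset c _ k (Finset.subset_univ c) (hcs.trans_le hs), hcs,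
    Finset.card_univ]

theorem overlap_le (φ ψ : Fin k ↪o Fin n) : overlap φ ψ ≤ k :=
  (Finset.card_le_card Finset.inter_subset_left).trans_eq (by simp)

theorem card_filter_overlap_eq_le (φ : Fin k ↪o Fin n) {s : ℕ} (hs : s ≤ k) :
    (Finset.univ.filter fun ψ : Fin k ↪o Fin n => overlap φ ψ = s).card ≤
      k.choose s * (n - s).choose (k - s) := by
  have h := card_filter_card_inter_eq_le (Finset.univ.map φ.toEmbedding) hs
  rw [Finset.card_map, Finset.card_univ, Fintype.card_fin, Fintype.card_fin] at h
  refine (Finset.card_le_card_of_injOn (fun ψ => Finset.univ.map ψ.toEmbedding) (fun ψ hψ => ?_)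
    fun ψ _ ψ' _ hψ => ?_).trans h
  · have hcard := (Finset.mem_filter.1 (Finset.mem_coe.1 hψ)).2
    simpa [overlap] using hcard
  · exact DFunLike.coe_injective <| (ψ.strictMono.range_inj ψ'.strictMono).1 <| by
      simpa using congrArg ((↑) : Finset (Fin n) → Set (Fin n)) hψ

theorem choose_mul_choose_sub_eq (hkn : k ≤ n) {s : ℕ} (hs : s ≤ k) :
    (k.choose s : ℝ) * (n - s).choose (k - s) =
      n.choose k * ((k.choose s : ℝ) ^ 2 / n.choose s) := by
  have hpos : (0 : ℝ) < n.choose s := Nat.cast_pos.2 (Nat.choose_pos (hs.trans hkn))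
  have hmul : (n.choose k : ℝ) * k.choose s = n.choose s * (n - s).choose (k - s) :=
    mod_cast Nat.choose_mul hs
  field_simp
  linear_combination -(k.choose s : ℝ) * hmul

theorem sum_overlapWeight_le (hkn : k ≤ n) (φ : Fin k ↪o Fin n) :
    ∑ ψ : Fin k ↪o Fin n, overlapWeight d q (overlap φ ψ) ≤ n.choose k * overlapSum d q n k := by
  have hweight : ∀ ψ : Fin k ↪o Fin n, overlapWeight d q (overlap φ ψ) =
      ∑ s ∈ Finset.Icc 1 k, if overlap φ ψ = s then (q : ℝ) ^ ((s : ℝ) ^ d / d) else 0 :=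
    fun ψ => by
    rw [Finset.sum_ite_eq, overlapWeight, ← ite_not]
    simp only [Finset.mem_Icc, overlap_le, and_true, Nat.one_le_iff_ne_zero]
  simp only [hweight]
  rw [Finset.sum_comm, overlapSum, Finset.mul_sum]
  refine Finset.sum_le_sum fun s hs => ?_
  have hsk := (Finset.mem_Icc.1 hs).2
  rw [← Finset.sum_filter, Finset.sum_const, nsmul_eq_mul, ← mul_assoc,
    ← choose_mul_choose_sub_eq hkn hsk]
  gcongr
  exact mod_cast card_filter_overlap_eq_le φ hsk

theorem sum_sum_prod_overlapWeight_le (hkn : k ≤ n) :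
    ∑ φ : Fin d → Fin k ↪o Fin n, ∑ ψ : Fin d → Fin k ↪o Fin n,
      ∏ t, overlapWeight d q (overlap (φ t) (ψ t)) ≤
        ((n.choose k : ℝ) ^ d) ^ 2 * overlapSum d q n k ^ d := by
  have hinner : ∀ φ : Fin d → Fin k ↪o Fin n, ∑ ψ : Fin d → Fin k ↪o Fin n,
      ∏ t, overlapWeight d q (overlap (φ t) (ψ t)) ≤
        (n.choose k * overlapSum d q n k : ℝ) ^ d := fun φ => by
    rw [← Fintype.prod_sum fun t ψ => overlapWeight d q (overlap (φ t) ψ)]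
    refine (Finset.prod_le_prod (fun t _ => Finset.sum_nonneg fun ψ _ =>
      overlapWeight_nonneg _ _ _) fun t _ => sum_overlapWeight_le hkn (φ t)).trans_eq ?_
    rw [Finset.prod_const, Finset.card_univ, Fintype.card_fin]
  refine (Finset.sum_le_card_nsmul _ _ _ fun φ _ => hinner φ).trans_eq ?_
  simp [card_fin_orderEmbedding_fin]
  ring

end Overlap

section CopyPattern

variable {d q : ℕ} {m n : Fin d → ℕ}

namespace DArray

/-- The positions and letters prescribed by the requirement that `φ` cuts out a copy of `B`. -/
def copyPattern (B : DArray q m) (φ : ∀ j, Fin (m j) ↪o Fin (n j)) :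
    Finset ((∀ j, Fin (n j)) × Fin q) :=
  Finset.univ.image fun i => (fun j => φ j (i j), B i)

theorem fst_mem_of_mem_copyPattern {B : DArray q m} {φ : ∀ j, Fin (m j) ↪o Fin (n j)}
    {x : (∀ j, Fin (n j)) × Fin q} (hx : x ∈ copyPattern B φ) (j : Fin d) :
    x.1 j ∈ Finset.univ.map (φ j).toEmbedding := by
  obtain ⟨i, -, rfl⟩ := Finset.mem_image.1 hx
  exact Finset.mem_map_of_mem _ (Finset.mem_univ (i j))

theorem pi_orderEmbedding_injective (φ : ∀ j, Fin (m j) ↪o Fin (n j)) :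
    Function.Injective fun (i : ∀ j, Fin (m j)) j => φ j (i j) :=
  Function.Injective.piMap fun j => (φ j).injective

theorem injOn_fst_copyPattern (B : DArray q m) (φ : ∀ j, Fin (m j) ↪o Fin (n j)) :
    Set.InjOn Prod.fst (copyPattern B φ : Set ((∀ j, Fin (n j)) × Fin q)) := by
  simp only [Set.InjOn, Finset.mem_coe, copyPattern, Finset.mem_image, Finset.mem_univ, true_and]
  rintro _ ⟨i, rfl⟩ _ ⟨i', rfl⟩ h
  rw [pi_orderEmbedding_injective φ h]

theorem card_copyPattern (B : DArray q m) (φ : ∀ j, Fin (m j) ↪o Fin (n j)) :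
    (copyPattern B φ).card = ∏ j, m j := by
  rw [copyPattern, Finset.card_image_of_injective]
  · simp
  · exact fun i i' h => pi_orderEmbedding_injective φ (congrArg Prod.fst h)

theorem card_copyPattern_inter_le (B : DArray q m) (φ ψ : ∀ j, Fin (m j) ↪o Fin (n j)) :
    (copyPattern B φ ∩ copyPattern B ψ).card ≤ ∏ j, overlap (φ j) (ψ j) := by
  simp only [overlap, ← Fintype.card_piFinset]
  refine Finset.card_le_card_of_injOn Prod.fst (fun x hx => ?_)
    ((injOn_fst_copyPattern B φ).mono (Finset.coe_subset.2 Finset.inter_subset_left))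
  have hx' := Finset.mem_inter.1 hx
  exact Fintype.mem_piFinset.2 fun j => Finset.mem_inter.2
    ⟨fst_mem_of_mem_copyPattern hx'.1 j, fst_mem_of_mem_copyPattern hx'.2 j⟩

theorem overlap_ne_zero_of_not_disjoint {B : DArray q m} {φ ψ : ∀ j, Fin (m j) ↪o Fin (n j)}
    (h : ¬ Disjoint (copyPattern B φ) (copyPattern B ψ)) (j : Fin d) :
    overlap (φ j) (ψ j) ≠ 0 := by
  obtain ⟨x, hφ, hψ⟩ := Finset.not_disjoint_iff.1 h
  exact Finset.card_ne_zero_of_mem <| Finset.mem_inter.2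
    ⟨fst_mem_of_mem_copyPattern hφ j, fst_mem_of_mem_copyPattern hψ j⟩

theorem subarray_eq_of_letterBits {A : DArray q n} {B : DArray q m}
    {φ : ∀ j, Fin (m j) ↪o Fin (n j)} (h : ∀ x ∈ copyPattern B φ, letterBits A x = true) :
    A.subarray φ = B :=
  funext fun i => of_decide_eq_true (h _ (Finset.mem_image_of_mem _ (Finset.mem_univ i)))

theorem overlapProb_copyPattern_le (hd : 0 < d) (hq : 0 < q) (B : DArray q m)
    (φ ψ : ∀ j, Fin (m j) ↪o Fin (n j)) :
    overlapProb (fun _ => (q : ℝ)⁻¹) (copyPattern B φ) (copyPattern B ψ) ≤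
      ((q : ℝ)⁻¹ ^ ∏ j, m j) ^ 2 * ∏ j, overlapWeight d q (overlap (φ j) (ψ j)) := by
  unfold overlapProb
  split_ifs with h
  · exact mul_nonneg (by positivity) (Finset.prod_nonneg fun j _ => overlapWeight_nonneg _ _ _)
  have hcard := Finset.card_union_add_card_inter (copyPattern B φ) (copyPattern B ψ)
  rw [card_copyPattern, card_copyPattern] at hcard
  have hq0 : (q : ℝ) ≠ 0 := Nat.cast_ne_zero.2 hq.ne'
  calc ∏ _b ∈ copyPattern B φ ∪ copyPattern B ψ, (q : ℝ)⁻¹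
      = ((q : ℝ)⁻¹ ^ ∏ j, m j) ^ 2 * (q : ℝ) ^ (copyPattern B φ ∩ copyPattern B ψ).card := by
        rw [Finset.prod_const, sq, ← pow_add, ← hcard, pow_add, mul_assoc, ← mul_pow,
          inv_mul_cancel₀ hq0, one_pow, mul_one]
    _ ≤ ((q : ℝ)⁻¹ ^ ∏ j, m j) ^ 2 * (q : ℝ) ^ ∏ j, overlap (φ j) (ψ j) := by
        gcongr
        · exact Nat.one_le_cast.2 hq
        · exact card_copyPattern_inter_le B φ ψ
    _ ≤ _ := by
        gcongr
        exact pow_prod_le_prod_overlapWeight hd hq (overlap_ne_zero_of_not_disjoint h)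

end DArray

variable {n k : ℕ}

theorem sum_sum_overlapProb_copyPattern_le (hd : 0 < d) (hq : 0 < q) (hkn : k ≤ n)
    (B : DArray q fun _ : Fin d => k) :
    ∑ φ : Fin d → Fin k ↪o Fin n, ∑ ψ : Fin d → Fin k ↪o Fin n,
      overlapProb (fun _ => (q : ℝ)⁻¹) (B.copyPattern φ) (B.copyPattern ψ) ≤
        ((n.choose k : ℝ) ^ d * (q : ℝ)⁻¹ ^ k ^ d) ^ 2 * overlapSum d q n k ^ d := by
  refine (Finset.sum_le_sum fun φ _ => Finset.sum_le_sum fun ψ _ =>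
    DArray.overlapProb_copyPattern_le hd hq B φ ψ).trans ?_
  simp only [← Finset.mul_sum, Finset.prod_const, Finset.card_univ, Fintype.card_fin]
  refine (mul_le_mul_of_nonneg_left (sum_sum_prod_overlapWeight_le hkn)
    (by positivity)).trans_eq ?_
  ring

theorem sum_prod_copyPattern (B : DArray q fun _ : Fin d => k) :
    ∑ φ : Fin d → Fin k ↪o Fin n, ∏ _b ∈ B.copyPattern φ, (q : ℝ)⁻¹ =
      (n.choose k : ℝ) ^ d * (q : ℝ)⁻¹ ^ k ^ d := by
  simp [DArray.card_copyPattern, card_fin_orderEmbedding_fin]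

theorem prodExp_noneTrue_copyPattern_le (hd : 0 < d) (hq : 0 < q) (hk : 0 < k) (hkn : k ≤ n)
    (B : DArray q fun _ : Fin d => k) :
    prodExp (fun (_ : Fin d → Fin n) (_ : Fin q) => (q : ℝ)⁻¹) (fun A =>
      noneTrue (fun φ : Fin d → Fin k ↪o Fin n => B.copyPattern φ) Finset.univ (letterBits A)) ≤
        Real.exp (-(1 / (2 * overlapSum d q n k ^ d))) := by
  have hq0 : (0 : ℝ) < q := Nat.cast_pos.2 hq
  have hq1 : (q : ℝ)⁻¹ ∈ Set.Icc (0 : ℝ) 1 :=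
    ⟨by positivity, inv_le_one_of_one_le₀ (Nat.one_le_cast.2 hq)⟩
  have hne : ∀ φ : Fin d → Fin k ↪o Fin n, (B.copyPattern φ).Nonempty := fun φ =>
    Finset.card_pos.1 <| (DArray.card_copyPattern B φ).symm ▸ Finset.prod_pos fun _ _ => hk
  refine (prodExp_noneTrue_letterBits_le (fun _ _ => hq1.1) (fun _ => by simp [hq0.ne'])
    fun φ _ => DArray.injOn_fst_copyPattern B φ).trans <|
      (bernoulliExp_noneTrue_le_exp_neg_sq (fun _ => hq1) hne).trans <|
        Real.exp_le_exp.2 (neg_le_neg ?_)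
  have hμΔ := sum_prod_le_sum_sum_overlapProb (p := fun _ => (q : ℝ)⁻¹) (fun _ => hq1) hne
  have hΔ := sum_sum_overlapProb_copyPattern_le hd hq hkn B
  have hG := overlapSum_pos (d := d) hq hk hkn
  rw [sum_prod_copyPattern] at hμΔ ⊢
  have hμ : 0 < (n.choose k : ℝ) ^ d * (q : ℝ)⁻¹ ^ k ^ d := by
    have := Nat.choose_pos hkn
    positivity
  rw [div_le_div_iff₀ (by positivity) (mul_pos two_pos (hμ.trans_le hμΔ))]
  linarith

theorem pow_mul_exp_lt_one_of_lt {q : ℕ} (hq : 0 < q) {N : ℕ} {G : ℝ} (hG : 0 < G)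
    (h : 2 * (N * Real.log q) * G < 1) : (q : ℝ) ^ N * Real.exp (-(1 / (2 * G))) < 1 := by
  rw [← Real.exp_log (Nat.cast_pos (α := ℝ).2 hq), ← Real.exp_nat_mul, ← Real.exp_add,
    Real.exp_lt_one_iff, ← sub_eq_add_neg, sub_neg, lt_div_iff₀ (by positivity)]
  linarith

theorem mem_universalOrders_of_overlapSum_pow_lt (hd : 0 < d) (hq : 0 < q) (hk : 0 < k)
    (hkn : k ≤ n) (h : 2 * ((k : ℝ) ^ d * Real.log q) * overlapSum d q n k ^ d < 1) :
    n ∈ DArray.universalOrders d q k := by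
  let avoids (B : (Fin d → Fin k) → Fin q) (A : (Fin d → Fin n) → Fin q) : ℝ :=
    noneTrue (fun φ : Fin d → Fin k ↪o Fin n =>
      DArray.copyPattern (m := fun _ => k) (n := fun _ => n) B φ) Finset.univ (letterBits A)
  have hmean : prodExp (fun (_ : Fin d → Fin n) (_ : Fin q) => (q : ℝ)⁻¹) (∑ B, avoids B) < 1 := by
    rw [map_sum]
    refine (Finset.sum_le_card_nsmul _ _ _ fun (B : (Fin d → Fin k) → Fin q) _ =>
      prodExp_noneTrue_copyPattern_le hd hq hk hkn B).trans_lt ?_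
    simpa using pow_mul_exp_lt_one_of_lt hq (N := k ^ d)
      (pow_pos (overlapSum_pos (d := d) hq hk hkn) d) (by exact_mod_cast h)
  obtain ⟨A, hA⟩ := exists_lt_of_prodExp_lt (fun _ _ => by positivity)
    (fun _ => by simp [hq.ne']) hmean
  have hlt : ∀ B, avoids B A < 1 := fun B => by
    rw [Finset.sum_apply] at hA
    exact (Finset.single_le_sum (f := fun B => avoids B A)
      (fun B _ => (noneTrue_mem_Icc _ _ _).1) (Finset.mem_univ B)).trans_lt hA
  refine ⟨A, DArray.isUniversal_of_forall_order hq fun B => DArray.contains_iff.2 ?_⟩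
  obtain ⟨φ, -, hφ⟩ := exists_forall_eq_true_of_noneTrue_lt_one (hlt B)
  exact ⟨φ, DArray.subarray_eq_of_letterBits hφ⟩

end CopyPattern

section FactorialBounds

theorem choose_le_mul_exp_div_pow (n k : ℕ) :
    (n.choose k : ℝ) ≤ (n * Real.exp 1 / k) ^ k := by
  rcases k.eq_zero_or_pos with rfl | hk
  · simp
  have hk0 : (0 : ℝ) < k := Nat.cast_pos.2 hk
  calc (n.choose k : ℝ) ≤ (n : ℝ) ^ k / k.factorial := Nat.choose_le_pow_div k n
    _ = (n / k : ℝ) ^ k * ((k : ℝ) ^ k / k.factorial) := by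
      rw [div_pow]
      field_simp
    _ ≤ (n / k : ℝ) ^ k * Real.exp k := by
      gcongr
      exact Real.pow_div_factorial_le_exp k hk0.le k
    _ = (n * Real.exp 1 / k) ^ k := by
      rw [← Real.exp_one_pow, ← mul_pow]
      ring

theorem factorial_le_exp_mul_mul_pow {k : ℕ} (hk : 0 < k) :
    (k.factorial : ℝ) ≤ Real.exp 1 * k * (k / Real.exp 1) ^ k := by
  obtain ⟨m, rfl⟩ := Nat.exists_eq_succ_of_ne_zero hk.ne'
  have hm : (1 : ℝ) ≤ m.succ := Nat.one_le_cast.2 hk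
  have h : Stirling.stirlingSeq m.succ ≤ Real.exp 1 / √2 :=
    Stirling.stirlingSeq_one ▸ Stirling.stirlingSeq'_antitone m.zero_le
  rw [Stirling.stirlingSeq, div_le_iff₀ (by positivity)] at h
  calc (m.succ.factorial : ℝ)
      ≤ Real.exp 1 / √2 * (√(2 * m.succ) * (m.succ / Real.exp 1) ^ m.succ) := h
    _ = Real.exp 1 * √m.succ * (m.succ / Real.exp 1) ^ m.succ := by
      rw [Real.sqrt_mul zero_le_two]
      field_simp
    _ ≤ _ := by
      gcongr
      exact Real.sqrt_le_iff.2 ⟨by positivity, le_self_pow₀ hm two_ne_zero⟩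

theorem pow_div_factorial_le_choose {n s : ℕ} {x : ℝ} (hx : 0 ≤ x) (h : x + s ≤ n) :
    x ^ s / s.factorial ≤ n.choose s := by
  refine le_trans ?_ (Nat.pow_le_choose s n)
  have hsn : s ≤ n := by exact_mod_cast (le_add_of_nonneg_left hx).trans h
  gcongr
  rw [Nat.cast_sub (hsn.trans n.le_succ), Nat.cast_succ]
  linarith

variable (s t : ℕ)

theorem factorial_mul_choose_le_pow : s.factorial * (s + t).choose s ≤ (s + t) ^ s :=
  Nat.descFactorial_eq_factorial_mul_choose (s + t) s ▸ Nat.descFactorial_le_pow (s + t) s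

theorem factorial_mul_choose_le_factorial :
    s.factorial * (s + t).choose s ≤ (s + t).factorial := by
  rw [← Nat.add_choose_mul_factorial_mul_factorial s t, Nat.choose_symm_add, mul_comm s.factorial]
  exact Nat.le_mul_of_pos_right _ t.factorial_pos

end FactorialBounds

/-- The claimed asymptotic value `(k / e) q ^ (k ^ (d - 1) / d)` of `f_d(q, k)`. -/
noncomputable def asymptoticOrder (d q k : ℕ) : ℝ :=
  (k : ℝ) / Real.exp 1 * (q : ℝ) ^ ((k : ℝ) ^ (d - 1) / (d : ℝ))

section AsymptoticOrder

variable {d q n k : ℕ}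

theorem asymptoticOrder_pos (hq : 0 < q) (hk : 0 < k) : 0 < asymptoticOrder d q k := by
  unfold asymptoticOrder
  positivity

theorem rpow_pow_sub_one_div_pow_pow (hd : d ≠ 0) :
    (((q : ℝ) ^ ((k : ℝ) ^ (d - 1) / d)) ^ k) ^ d = (q : ℝ) ^ k ^ d := by
  rw [← pow_mul, ← Real.rpow_mul_natCast q.cast_nonneg, ← Real.rpow_natCast (q : ℝ) (k ^ d)]
  congr 1
  push_cast
  rw [mul_comm (k : ℝ), ← mul_assoc, div_mul_cancel₀ _ (Nat.cast_ne_zero.2 hd),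
    pow_sub_one_mul hd]

theorem asymptoticOrder_le_of_mem (hd : 0 < d) (hk : 0 < k)
    (hn : n ∈ DArray.universalOrders d q k) : asymptoticOrder d q k ≤ n := by
  obtain ⟨A, hA⟩ := hn
  have hchoose : (((q : ℝ) ^ ((k : ℝ) ^ (d - 1) / d)) ^ k) ^ d ≤ (n.choose k : ℝ) ^ d := by
    rw [rpow_pow_sub_one_div_pow_pow hd.ne']
    exact_mod_cast hA.pow_le_choose_pow
  have hbase : (q : ℝ) ^ ((k : ℝ) ^ (d - 1) / d) ≤ n * Real.exp 1 / k :=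
    le_of_pow_le_pow_left₀ hk.ne' (by positivity) <|
      (le_of_pow_le_pow_left₀ hd.ne' (by positivity) hchoose).trans (choose_le_mul_exp_div_pow n k)
  calc asymptoticOrder d q k ≤ k / Real.exp 1 * (n * Real.exp 1 / k) :=
        mul_le_mul_of_nonneg_left hbase (by positivity)
    _ = n := by field_simp

theorem eventually_mul_le_asymptoticOrder (hd : 2 ≤ d) (hq : 2 ≤ q) (C : ℝ) :
    ∀ᶠ k : ℕ in atTop, C * k ≤ asymptoticOrder d q k := by
  have hq1 : (1 : ℝ) < q := Nat.one_lt_cast.2 hq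
  have hroot : 1 < (q : ℝ) ^ (1 / (d : ℝ)) := Real.one_lt_rpow hq1 (by positivity)
  filter_upwards [(tendsto_pow_atTop_atTop_of_one_lt hroot).eventually_ge_atTop (C * Real.exp 1),
    eventually_ge_atTop 1] with k hC hk
  have hexp : ((q : ℝ) ^ (1 / (d : ℝ))) ^ k ≤ (q : ℝ) ^ ((k : ℝ) ^ (d - 1) / d) := by
    rw [← Real.rpow_mul_natCast q.cast_nonneg, one_div_mul_eq_div]
    gcongr
    · exact hq1.le
    · exact le_self_pow₀ (Nat.one_le_cast.2 hk) (by lia)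
  calc C * k = k / Real.exp 1 * (C * Real.exp 1) := by field_simp
    _ ≤ asymptoticOrder d q k := mul_le_mul_of_nonneg_left (hC.trans hexp) (by positivity)

end AsymptoticOrder

section OverlapAsymptotics

theorem rpow_pow_div_le {d q : ℕ} (hd : 2 ≤ d) (hq : 0 < q) (s t : ℕ) :
    (q : ℝ) ^ ((s : ℝ) ^ d / d) ≤ ((q : ℝ) ^ (((s + t : ℕ) : ℝ) ^ (d - 1) / (d : ℝ))) ^ s *
      ((q : ℝ) ^ (-(1 / (2 * d) : ℝ))) ^ (2 * (s * t)) := by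
  have hq0 : (0 : ℝ) < q := Nat.cast_pos.2 hq
  have hpow : (s : ℝ) ^ (d - 1) + t ≤ ((s + t : ℕ) : ℝ) ^ (d - 1) := by
    have hd1 : d - 1 ≠ 0 := by lia
    exact_mod_cast (Nat.add_le_add_left (Nat.le_self_pow hd1 t) _).trans
      (pow_add_pow_le s.zero_le t.zero_le hd1)
  rw [← Real.rpow_mul_natCast hq0.le, ← Real.rpow_mul_natCast hq0.le, ← Real.rpow_add hq0]
  refine Real.rpow_le_rpow_of_exponent_le (Nat.one_le_cast.2 hq) ?_
  calc (s : ℝ) ^ d / d = ((s : ℝ) ^ (d - 1) + t) * s / d - s * t / d := by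
        rw [← pow_sub_one_mul (by lia : d ≠ 0)]
        ring
    _ ≤ ((s + t : ℕ) : ℝ) ^ (d - 1) * s / d - s * t / d := by gcongr
    _ = _ := by
      push_cast
      field_simp
      ring

variable {s t : ℕ} {b c : ℝ}

theorem choose_mul_factorial_mul_choose_mul_le_of_le (hs : 0 < s) (hst : s ≤ t)
    (hb : b ∈ Set.Icc (0 : ℝ) 1) (hc : c ∈ Set.Icc (0 : ℝ) 1)
    (hsmall : Real.exp 1 * (s + t : ℕ) * c ^ (s + t) ≤ 1) :
    ((s + t).choose s : ℝ) * (s.factorial * (s + t).choose s) *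
      ((Real.exp 1 / (s + t : ℕ)) ^ s * b ^ (2 * s) * c ^ (2 * (s * t))) ≤
        Real.exp 1 * (s + t : ℕ) * c ^ (s + t) := by
  have hbs : b ^ (2 * s) ≤ 1 := pow_le_one₀ hb.1 hb.2
  have hcs : c ^ (2 * (s * t)) ≤ (c ^ (s + t)) ^ s := by
    rw [← pow_mul]
    exact pow_le_pow_of_le_one hc.1 hc.2 (by nlinarith)
  have hC : ((s + t).choose s : ℝ) ≤ ((s + t : ℕ) : ℝ) ^ s := by
    exact_mod_cast Nat.choose_le_pow (s + t) s
  have hsC : (s.factorial * (s + t).choose s : ℝ) ≤ ((s + t : ℕ) : ℝ) ^ s := by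
    exact_mod_cast factorial_mul_choose_le_pow s t
  have hk : 0 < ((s + t : ℕ) : ℝ) := Nat.cast_pos.2 (by lia)
  generalize ((s + t : ℕ) : ℝ) = k at *
  have hc0 := hc.1
  have hb0 := hb.1
  calc _ ≤ k ^ s * k ^ s * ((Real.exp 1 / k) ^ s * 1 * (c ^ (s + t)) ^ s) := by gcongr
    _ = (Real.exp 1 * k * c ^ (s + t)) ^ s := by
      rw [mul_one, ← mul_pow, ← mul_pow, ← mul_pow]
      congr 1
      field_simp
    _ ≤ Real.exp 1 * k * c ^ (s + t) := pow_le_of_le_one (by positivity) hsmall hs.ne'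

theorem choose_mul_factorial_mul_choose_mul_le_of_ge (hs : 0 < s) (hts : t ≤ s)
    (hb : b ∈ Set.Icc (0 : ℝ) 1) (hc : c ∈ Set.Icc (0 : ℝ) 1)
    (hsmall : ((s + t : ℕ) : ℝ) ^ 2 / Real.exp 1 * c ^ (s + t) ≤ 1) :
    ((s + t).choose s : ℝ) * (s.factorial * (s + t).choose s) *
      ((Real.exp 1 / (s + t : ℕ)) ^ s * b ^ (2 * s) * c ^ (2 * (s * t))) ≤
        Real.exp 1 * (s + t : ℕ) * b ^ (s + t) := by
  have hbs : b ^ (2 * s) ≤ b ^ (s + t) := pow_le_pow_of_le_one hb.1 hb.2 (by lia)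
  have hcs : c ^ (2 * (s * t)) ≤ (c ^ (s + t)) ^ t := by
    rw [← pow_mul]
    exact pow_le_pow_of_le_one hc.1 hc.2 (by nlinarith)
  have hC : ((s + t).choose s : ℝ) ≤ ((s + t : ℕ) : ℝ) ^ t := by
    rw [Nat.choose_symm_add]
    exact_mod_cast Nat.choose_le_pow (s + t) t
  have hsC : (s.factorial * (s + t).choose s : ℝ) ≤
      Real.exp 1 * (s + t : ℕ) * ((s + t : ℕ) / Real.exp 1) ^ (s + t) :=
    le_trans (by exact_mod_cast factorial_mul_choose_le_factorial s t)
      (factorial_le_exp_mul_mul_pow (by lia))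
  have hk : 0 < ((s + t : ℕ) : ℝ) := Nat.cast_pos.2 (by lia)
  generalize ((s + t : ℕ) : ℝ) = k at *
  have hb0 := hb.1
  have hc0 := hc.1
  calc _ ≤ k ^ t * (Real.exp 1 * k * (k / Real.exp 1) ^ (s + t)) *
        ((Real.exp 1 / k) ^ s * b ^ (s + t) * (c ^ (s + t)) ^ t) := by gcongr
    _ = Real.exp 1 * k * b ^ (s + t) * (k ^ 2 / Real.exp 1 * c ^ (s + t)) ^ t := by
      simp only [pow_add (k / Real.exp 1), div_pow, mul_pow _ (c ^ (s + t))]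
      field_simp
      ring
    _ ≤ Real.exp 1 * k * b ^ (s + t) :=
      mul_le_of_le_one_right (by positivity) (pow_le_one₀ (by positivity) hsmall)

variable {d q n k : ℕ}

theorem choose_sq_div_choose_mul_rpow_le (hd : 2 ≤ d) (hq : 0 < q) (hs : 0 < s) (hb : 0 < b)
    (hn : asymptoticOrder d q (s + t) / b ^ 2 + (s + t : ℕ) ≤ n) :
    ((s + t).choose s : ℝ) ^ 2 / n.choose s * (q : ℝ) ^ ((s : ℝ) ^ d / d) ≤
      (s + t).choose s * (s.factorial * (s + t).choose s) *
        ((Real.exp 1 / (s + t : ℕ)) ^ s * b ^ (2 * s) *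
          ((q : ℝ) ^ (-(1 / (2 * d) : ℝ))) ^ (2 * (s * t))) := by
  have hT : 0 < asymptoticOrder d q (s + t) / b ^ 2 :=
    div_pos (asymptoticOrder_pos hq (by lia)) (pow_pos hb 2)
  have hchoose := pow_div_factorial_le_choose (s := s) (n := n) hT.le <| le_trans
    (add_le_add_right (Nat.cast_le.2 (Nat.le_add_right s t)) _) hn
  refine (mul_le_mul (div_le_div_of_nonneg_left (by positivity) (by positivity) hchoose)
    (rpow_pow_div_le hd hq s t) (by positivity) (by positivity)).trans_eq ?_
  have hcancel : (asymptoticOrder d q (s + t) / b ^ 2) ^ s *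
      ((Real.exp 1 / (s + t : ℕ)) ^ s * b ^ (2 * s)) =
        ((q : ℝ) ^ (((s + t : ℕ) : ℝ) ^ (d - 1) / (d : ℝ))) ^ s := by
    have hk : ((s + t : ℕ) : ℝ) ≠ 0 := Nat.cast_ne_zero.2 (by lia)
    rw [pow_mul, ← mul_pow, ← mul_pow, asymptoticOrder]
    congr 1
    field_simp
  rw [← hcancel]
  generalize asymptoticOrder d q (s + t) / b ^ 2 = x at *
  field_simp

theorem overlapSum_le (hd : 2 ≤ d) (hq : 0 < q) (hb : b ∈ Set.Ioc (0 : ℝ) 1)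
    (hn : asymptoticOrder d q k / b ^ 2 + k ≤ n) (hcq : c = (q : ℝ) ^ (-(1 / (2 * d) : ℝ)))
    (hsmall : Real.exp 1 * k ^ 2 * c ^ k ≤ 1) :
    overlapSum d q n k ≤ Real.exp 1 * k ^ 2 * (b ^ k + c ^ k) := by
  have hc : c ∈ Set.Icc (0 : ℝ) 1 := hcq ▸ ⟨by positivity,
    Real.rpow_le_one_of_one_le_of_nonpos (Nat.one_le_cast.2 hq) (by simp)⟩
  have hb' : b ∈ Set.Icc (0 : ℝ) 1 := ⟨hb.1.le, hb.2⟩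
  have hb0 := hb.1
  have hc0 := hc.1
  have hterm : ∀ s ∈ Finset.Icc 1 k,
      (k.choose s : ℝ) ^ 2 / n.choose s * (q : ℝ) ^ ((s : ℝ) ^ d / d) ≤
        Real.exp 1 * k * (b ^ k + c ^ k) := by
    intro s hs
    obtain ⟨hs1, hsk⟩ := Finset.mem_Icc.1 hs
    have hk1 : (1 : ℝ) ≤ k := Nat.one_le_cast.2 (hs1.trans hsk)
    obtain ⟨t, rfl⟩ := Nat.exists_eq_add_of_le hsk
    refine (choose_sq_div_choose_mul_rpow_le hd hq hs1 hb.1 hn).trans ?_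
    rw [← hcq, mul_add]
    rcases le_total s t with hst | hts
    · refine (choose_mul_factorial_mul_choose_mul_le_of_le hs1 hst hb' hc (hsmall.trans' ?_)).trans
        (le_add_of_nonneg_left (by positivity))
      gcongr
      exact le_self_pow₀ hk1 two_ne_zero
    · refine (choose_mul_factorial_mul_choose_mul_le_of_ge hs1 hts hb' hc (hsmall.trans' ?_)).trans
        (le_add_of_nonneg_right (by positivity))
      rw [div_eq_inv_mul]
      gcongr
      exact (inv_le_one_of_one_le₀ (Real.one_le_exp zero_le_one)).trans
        (Real.one_le_exp zero_le_one)
  refine (Finset.sum_le_sum hterm).trans_eq ?_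
  simp only [Finset.sum_const, Nat.card_Icc, Nat.add_sub_cancel, nsmul_eq_mul]
  ring

theorem eventually_mem_universalOrders (hd : 2 ≤ d) (hq : 2 ≤ q) (hb : b ∈ Set.Ioo (0 : ℝ) 1) :
    ∀ᶠ k : ℕ in atTop, ∀ n : ℕ, asymptoticOrder d q k / b ^ 2 + k ≤ n →
      n ∈ DArray.universalOrders d q k := by
  set c : ℝ := (q : ℝ) ^ (-(1 / (2 * d) : ℝ)) with hcq
  have hq1 : (1 : ℝ) < q := Nat.one_lt_cast.2 hq
  have hc : |c| < 1 := by
    rw [abs_of_nonneg (by positivity)]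
    exact Real.rpow_lt_one_of_one_lt_of_neg hq1 (neg_neg_of_pos (by positivity))
  have hdecay (j : ℕ) : Tendsto (fun k : ℕ => (k : ℝ) ^ j * c ^ k) atTop (nhds 0) :=
    tendsto_pow_const_mul_const_pow_of_abs_lt_one j hc
  have hsmall := (hdecay 2).const_mul (Real.exp 1)
  have hsum := (((((tendsto_pow_const_mul_const_pow_of_abs_lt_one 3
    (abs_lt.2 ⟨by linarith [hb.1], hb.2⟩)).add (hdecay 3)).const_mul (Real.exp 1)).pow d).const_mul
      (2 * Real.log q))
  rw [mul_zero] at hsmall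
  rw [add_zero, mul_zero, zero_pow (by lia), mul_zero] at hsum
  filter_upwards [hsmall.eventually_le_const one_pos, hsum.eventually_lt_const one_pos,
    eventually_gt_atTop 0] with k hsmall hsum hk n hn
  have hkn : k ≤ n := by
    exact_mod_cast (le_add_of_nonneg_left (div_nonneg (asymptoticOrder_pos (by lia) hk).le
      (sq_nonneg b))).trans hn
  refine mem_universalOrders_of_overlapSum_pow_lt (by lia) (by lia) hk hkn (hsum.trans_le' ?_)
  have hG := overlapSum_le hd (by lia) ⟨hb.1, hb.2.le⟩ hn hcq (by rwa [mul_assoc])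
  have hG0 := overlapSum_pos (d := d) (by lia : 0 < q) hk hkn
  have : 0 ≤ Real.log q := Real.log_nonneg hq1.le
  calc 2 * ((k : ℝ) ^ d * Real.log q) * overlapSum d q n k ^ d
      = 2 * Real.log q * (k * overlapSum d q n k) ^ d := by
        rw [mul_pow]
        ring
    _ ≤ 2 * Real.log q * (k * (Real.exp 1 * k ^ 2 * (b ^ k + c ^ k))) ^ d := by gcongr
    _ = _ := by ring

theorem universalOrders_nonempty (hd : 2 ≤ d) (hq : 2 ≤ q) (k : ℕ) :
    (DArray.universalOrders d q k).Nonempty := by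
  obtain ⟨l, hl, hkl⟩ := ((eventually_mem_universalOrders hd hq (b := 1 / 2)
    ⟨by norm_num, by norm_num⟩).and (eventually_ge_atTop k)).exists
  exact ⟨_, DArray.universalOrders_anti d q hkl (hl _ (Nat.le_ceil _))⟩

theorem isLeast_minUniversalOrder (hd : 2 ≤ d) (hq : 2 ≤ q) (k : ℕ) :
    IsLeast (DArray.universalOrders d q k) (DArray.minUniversalOrder d q k) :=
  ⟨Nat.sInf_mem (universalOrders_nonempty hd hq k), fun _ hn => Nat.sInf_le hn⟩

theorem eventually_minUniversalOrder_le (hd : 2 ≤ d) (hq : 2 ≤ q) {ε : ℝ} (hε : 0 < ε) :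
    ∀ᶠ k : ℕ in atTop,
      (DArray.minUniversalOrder d q k : ℝ) ≤ (1 + ε) * asymptoticOrder d q k := by
  obtain ⟨b, hb, hbε⟩ : ∃ b ∈ Set.Ioo (0 : ℝ) 1, 1 / b ^ 2 = 1 + ε / 2 := by
    refine ⟨√(1 / (1 + ε / 2)), ⟨by positivity, ?_⟩, ?_⟩
    · rw [Real.sqrt_lt' one_pos, one_pow, div_lt_one (by positivity)]
      linarith
    · rw [Real.sq_sqrt (by positivity), one_div_one_div]
  filter_upwards [eventually_mem_universalOrders hd hq hb,
    eventually_mul_le_asymptoticOrder hd hq (4 / ε), eventually_gt_atTop 0] with k hmem hbig hk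
  have hT := asymptoticOrder_pos (d := d) (by lia : 0 < q) hk
  have hk1 : (1 : ℝ) ≤ k := Nat.one_le_cast.2 hk
  rw [div_mul_eq_mul_div, div_le_iff₀ hε] at hbig
  have hfloor := Nat.lt_floor_add_one ((1 + ε) * asymptoticOrder d q k)
  have hn : asymptoticOrder d q k / b ^ 2 + k ≤ ⌊(1 + ε) * asymptoticOrder d q k⌋₊ := by
    rw [div_eq_mul_one_div, hbε]
    linarith
  exact (Nat.cast_le.2 (Nat.sInf_le (hmem _ hn))).trans (Nat.floor_le (by positivity))

end OverlapAsymptotics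

theorem isEquivalent_of_le_of_eventually_le_one_add_mul {α : Type*} {l : Filter α} {u v : α → ℝ}
    (hv : v ≤ᶠ[l] u) (hu : ∀ ε > 0, ∀ᶠ x in l, u x ≤ (1 + ε) * v x) :
    Asymptotics.IsEquivalent l u v := by
  refine Asymptotics.isLittleO_iff.2 fun ε hε => ?_
  filter_upwards [hv, hu ε hε] with x hvx hux
  rw [Pi.sub_apply, Real.norm_of_nonneg (sub_nonneg.2 hvx)]
  calc u x - v x ≤ ε * v x := by linarith
    _ ≤ ε * ‖v x‖ := by
      gcongr
      exact Real.le_norm_self _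

theorem corollary4 (d q : ℕ) (hd : 2 ≤ d) (hq : 2 ≤ q) :
    (∀ k : ℕ, 1 ≤ k →
      IsLeast (DArray.universalOrders d q k) (DArray.minUniversalOrder d q k)) ∧
    Asymptotics.IsEquivalent atTop
      (fun k : ℕ => (DArray.minUniversalOrder d q k : ℝ))
      (fun k : ℕ => (k : ℝ) / Real.exp 1 * (q : ℝ) ^ ((k : ℝ) ^ (d - 1) / (d : ℝ))) := by
  refine ⟨fun k _ => isLeast_minUniversalOrder hd hq k,
    isEquivalent_of_le_of_eventually_le_one_add_mul ?_ fun ε hε =>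
      eventually_minUniversalOrder_le hd hq hε⟩
  filter_upwards [eventually_gt_atTop 0] with k hk
  exact asymptoticOrder_le_of_mem (by lia) hk (isLeast_minUniversalOrder hd hq k).1
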